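/- \textbf{Setting.} There are $K$ users, $L$ slots per scheduling interval, and channel matrices $H_k^{\ell}\in\mathbb C^{N_k\times M}$ ($1\le k\le K$, $1\le \ell\le L$) that are the same in all scheduling intervals: $H_k^{sL+\ell}=H_k^{\ell}$ for all integers $s\ge 0$. Let $\Theta>0$ be the rate threshold, $\mu_k\ge 0$ the user weights, $P$ the power budget, $\mathcal C_c=\{W\in\mathbb C^{M\times d}:\|W\|_F^2\le P\}$ the continuous codebook, and $R_k^\tau(W)=\log|I+H_k^\tau WW^\dagger H_k^{\tau\dagger}|$ (natural logarithm). The relaxed weighted-sum-delay problem is $$(\mathrm{P2}')\qquad \sum_k\mu_k+\min_{\{W^\tau\in\mathcal C_c\}_{\tau\ge1}}\ \sum_{k=1}^K\sum_{t=1}^{\infty}\mu_k\Big[1-\min\Big\{\tfrac1\Theta\sum_{\tau=1}^{Lt}R_k^\tau(W^\tau),\,1\Big\}\Big].$$ \textbf{Stationary points.} For $T\in\mathbb N\cup\{\infty\}$, a sequence $\{W^\tau\}$ is a KKT point of the problem with horizon $T$ (the sum over $t$ restricted to $t\le T$; $T=\infty$ is (P2$'$)) if, with $\rho_k^t=\sum_{\tau\le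 Lt}R_k^\tau(W^\tau)$ and $\alpha_k^t=\min\{\rho_k^t/\Theta,1\}$, one has $W^\tau\in\mathcal C_c$ for all slots $\tau\le LT$ and there are multipliers $\lambda_k^t,\nu_k^t,\delta^\tau\ge0$ ($t\le T$, $\tau\le LT$) with $\sum_t\lambda_k^t<\infty$ for every $k$, $$\Theta\lambda_k^t+\nu_k^t=\mu_k,\qquad \lambda_k^t(\Theta\alpha_k^t-\rho_k^t)=0,\qquad \nu_k^t(\alpha_k^t-1)=0,\qquad \delta^\tau(\|W^\tau\|_F^2-P)=0,$$ $$\sum_{k=1}^K\Big(\sum_{\lceil\tau/L\rceil\le t\le T}\lambda_k^t\Big)\nabla R_k^\tau(W^\tau)=\delta^\tau\,\nabla\|\cdot\|_F^2(W^\tau)\quad\text{for every } \tau\le LT .$$ These are the KKT conditions of the smooth form of the problem, in which $\alpha_k^t$ are variables subject to $\Theta\alpha_k^t\le\rho_k^t$ and $\alpha_k^t\le1$. A stationary point of (P2$'$) is a KKT point for $T=\infty$ at which the objective value of (P2$'$) is finite. \textbf{Algorithm 4.} Inputs: an initial number $\tilde t$ of intervals, the channels, and precoders $\breve W^{(1)},\dots,\breve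 W^{(L)}\in\mathcal C_c$ with $\Delta_k:=\sum_{\ell=1}^L R_k^\ell(\breve W^{(\ell)})>0$ for every $k$. Before the first pass nothing is transmitted (all precoders are $0$). While some user's accumulated rate $\sum_{\tau=1}^{L\tilde t}R_k^\tau(W^\tau)$ is below $\Theta-\Delta_k$: increase $\tilde t$ by one; choose any initialization $\{W^\tau\in\mathcal C_c\}_{\tau=1}^{L\tilde t}$; run the cyclic alternating ascent (CAA) loop, which repeats the updates $$G_k^\tau\leftarrow (H_k^\tau W^\tau W^{\tau\dagger}H_k^{\tau\dagger}+I)^{-1}H_k^\tau W^\tau,\qquad S_k^\tau\leftarrow W^{\tau\dagger}H_k^{\tau\dagger}H_k^\tau W^\tau+I=B_k^\tau B_k^{\tau\dagger}\ \text{(Cholesky)},$$ and then replaces $\{W^\tau\}$ by the precoder part of an optimal solution of the second-order cone program $$\max_{\{W^\tau\in\mathcal C_c\},\{\alpha_k^t,\beta_k^\tau\}}\ \sum_{k=1}^K\sum_{t=1}^{\tilde t}\mu_k\alpha_k^t$$ subject to, for all $k$, $1\le t\le\tilde t$ and $1\le\tau\le L\tilde t$, $$\Theta\alpha_k^t\le\sum_{\tau=1}^{Lt}\big\{-\|G_k^\tau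 B_k^\tau\|_F^2-\beta_k^\tau+\log|S_k^\tau|+d\big\},\quad \beta_k^\tau\ge\|B_k^{\tau\dagger}(G_k^{\tau\dagger}H_k^\tau W^\tau-I)\|_F^2,\quad \alpha_k^t\le1;$$ and take as the new $\{W^\tau\}_{\tau=1}^{L\tilde t}$ the limit, or any accumulation point, of the iterates of the loop. When the while loop stops, output $\{W^\tau\}_{\tau=1}^{L\tilde t}$ if every user's accumulated rate is at least $\Theta$; otherwise append one more interval, $W^{L\tilde t+\ell}=\breve W^{(\ell)}$ for $1\le\ell\le L$, and output the result. The output is continued by $W^\tau=0$ in all later slots. \textbf{Proposition 6.} For every initialization chosen in each pass, the output of Algorithm 4 upon termination is a stationary point of (P2$'$). Moreover, if the output comprises $n$ scheduling intervals, then for every finite $T\ge n$ it is a KKT point of the problem with horizon $T$. -/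

import Mathlib

open Filter Topology Matrix
open scoped BigOperators

-- The norm of a matrix is the Frobenius norm throughout.
attribute [local instance] Matrix.frobeniusNormedAddCommGroup Matrix.frobeniusNormedSpace

/-- The data of the multicast precoding problem: `K` users, `L` slots per scheduling interval,
`M` transmit antennas, at most `d` streams, `N k` receive antennas at user `k`; the channel matrix
`H k ℓ` of user `k` on slot `ℓ` of every scheduling interval (quasi-static fading), the power
budget `P`, the rate threshold `Θ` and the user weights `μ`. -/
structure MulticastSystem (K L M d : ℕ) (N : Fin K → ℕ) where
  H : (k : Fin K) → Fin L → Matrix (Fin (N k)) (Fin M) ℂ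
  P : ℝ
  Θ : ℝ
  μ : Fin K → ℝ

/-- A precoder for each slot of `t` successive scheduling intervals; slot `ℓ` of interval `s`
(both counted from `0`) is the slot number `L * s + ℓ + 1`. -/
abbrev FinSchedule (L M d t : ℕ) := Fin t → Fin L → Matrix (Fin M) (Fin d) ℂ

/-- A precoder for each slot of each scheduling interval, over an infinite time horizon. -/
abbrev Schedule (L M d : ℕ) := ℕ → Fin L → Matrix (Fin M) (Fin d) ℂ

/-- No transmission after the last scheduling interval. -/
def FinSchedule.extend {L M d t : ℕ} (W : FinSchedule L M d t) : Schedule L M d :=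
  fun s => if h : s < t then W ⟨s, h⟩ else 0

/-- Append one scheduling interval with the precoders `V`, and transmit nothing afterwards. -/
def FinSchedule.augment {L M d t : ℕ} (W : FinSchedule L M d t)
    (V : Fin L → Matrix (Fin M) (Fin d) ℂ) : Schedule L M d :=
  fun s => if h : s < t then W ⟨s, h⟩ else if s = t then V else 0

/-- `B` is the Cholesky factor of `S`: `S = B Bᴴ` with `B` lower triangular with positive
diagonal. -/
def IsCholeskyFactor {d : ℕ} (S B : Matrix (Fin d) (Fin d) ℂ) : Prop :=
  S = B * Bᴴ ∧ (∀ i j, i < j → B i j = 0) ∧ ∀ i, 0 < (B i i).re ∧ (B i i).im = 0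

namespace MulticastSystem

variable {K L M d : ℕ} {N : Fin K → ℕ} (Sys : MulticastSystem K L M d N)

/-- The continuous codebook: the precoders of squared Frobenius norm at most `P`. -/
def codebook : Set (Matrix (Fin M) (Fin d) ℂ) := {W | ‖W‖ ^ 2 ≤ Sys.P}

/-- The achievable rate `log |I + H W Wᴴ Hᴴ|` of user `k` on slot `ℓ` of an interval. -/
noncomputable def rate (k : Fin K) (ℓ : Fin L) (W : Matrix (Fin M) (Fin d) ℂ) : ℝ :=
  Real.log (1 + Sys.H k ℓ * W * Wᴴ * (Sys.H k ℓ)ᴴ).det.re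

/-- The rate of user `k` in one scheduling interval with the precoders `V`. -/
noncomputable def intervalRate (k : Fin K) (V : Fin L → Matrix (Fin M) (Fin d) ℂ) : ℝ :=
  ∑ ℓ, Sys.rate k ℓ (V ℓ)

/-- The rate accumulated by user `k` in the first `t` scheduling intervals. -/
noncomputable def accRate (W : Schedule L M d) (k : Fin K) (t : ℕ) : ℝ :=
  ∑ s ∈ Finset.range t, Sys.intervalRate k (W s)

/-- The relaxed indicator `min {χ, 1}` at the normalized rate `χ` accumulated by user `k` in the
first `t` scheduling intervals. -/
noncomputable def relInd (W : Schedule L M d) (k : Fin K) (t : ℕ) : ℝ :=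
  min (Sys.accRate W k t / Sys.Θ) 1

/-! ### Stationary points of the relaxed weighted sum delay problem -/

/-- `W` is a KKT point of the relaxed weighted sum delay problem over `T` scheduling intervals,
with `T = ⊤` for the infinite horizon: minimize, up to an additive constant,
`∑ k, ∑ u < T, μ k * (1 - min {accRate W k (u+1) / Θ, 1})` over `W s ℓ ∈ codebook`, `s < T`.
In the smooth form of the problem, the relaxed indicator is a variable `α k u`, and one minimizes
`∑ k, ∑ u < T, μ k * (1 - α k u)` subject to
`Θ * α k u ≤ accRate W k (u+1)` (multiplier `lam k u`), `α k u ≤ 1` (multiplier `nu k u`) and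
`‖W s ℓ‖ ^ 2 ≤ P` (multiplier `δ s ℓ`). The partial derivatives of the Lagrangian in every
`α k u` and in every `W s ℓ` vanish; note that `W s ℓ` contributes `rate k ℓ (W s ℓ)` to
`accRate W k (u+1)` for `u ≥ s`. -/
def IsKKTPoint (T : ℕ∞) (W : Schedule L M d) : Prop :=
  (∀ s : ℕ, (s : ℕ∞) < T → ∀ ℓ, W s ℓ ∈ Sys.codebook) ∧
  ∃ (lam nu : Fin K → ℕ → ℝ) (δ : ℕ → Fin L → ℝ),
    (∀ k, Summable fun u : {u : ℕ // (u : ℕ∞) < T} => lam k u) ∧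
    (∀ k, ∀ u : ℕ, (u : ℕ∞) < T →
      0 ≤ lam k u ∧ 0 ≤ nu k u ∧
      lam k u * (Sys.Θ * Sys.relInd W k (u + 1) - Sys.accRate W k (u + 1)) = 0 ∧
      nu k u * (Sys.relInd W k (u + 1) - 1) = 0 ∧
      -Sys.μ k + lam k u * Sys.Θ + nu k u = 0) ∧
    (∀ s : ℕ, (s : ℕ∞) < T → ∀ ℓ,
      0 ≤ δ s ℓ ∧
      δ s ℓ * (‖W s ℓ‖ ^ 2 - Sys.P) = 0 ∧
      HasFDerivAt (𝕜 := ℝ)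
        (fun V : Matrix (Fin M) (Fin d) ℂ =>
          -(∑ k, (∑' u : {u : ℕ // s ≤ u ∧ (u : ℕ∞) < T}, lam k u) * Sys.rate k ℓ V)
            + δ s ℓ * (‖V‖ ^ 2 - Sys.P))
        0 (W s ℓ))

/-- `W` is a stationary point of the relaxed weighted sum delay problem: a feasible point with a
finite (convergent) objective value that satisfies the KKT conditions. -/
def IsStationaryPoint (W : Schedule L M d) : Prop :=
  (∀ k, Summable fun u : ℕ => Sys.μ k * (1 - Sys.relInd W k (u + 1))) ∧ Sys.IsKKTPoint ⊤ W

/-! ### The algorithm -/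

/-- The LMMSE receive filter of user `k` on slot `ℓ` for the precoder `W`. -/
noncomputable def lmmse (k : Fin K) (ℓ : Fin L) (W : Matrix (Fin M) (Fin d) ℂ) :
    Matrix (Fin (N k)) (Fin d) ℂ :=
  (Sys.H k ℓ * W * Wᴴ * (Sys.H k ℓ)ᴴ + 1)⁻¹ * Sys.H k ℓ * W

/-- The slack matrix of user `k` on slot `ℓ` for the precoder `W`. -/
def slack (k : Fin K) (ℓ : Fin L) (W : Matrix (Fin M) (Fin d) ℂ) :
    Matrix (Fin d) (Fin d) ℂ :=
  Wᴴ * (Sys.H k ℓ)ᴴ * Sys.H k ℓ * W + 1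

/-- Feasibility of `(W, α, β)` for the second-order cone program with `t` scheduling intervals,
for fixed filters `G`, slack matrices `S` and their Cholesky factors `B`. -/
def SOCPFeasible {t : ℕ}
    (G : (k : Fin K) → Fin t → Fin L → Matrix (Fin (N k)) (Fin d) ℂ)
    (S B : Fin K → Fin t → Fin L → Matrix (Fin d) (Fin d) ℂ)
    (W : FinSchedule L M d t) (α : Fin K → Fin t → ℝ) (β : Fin K → Fin t → Fin L → ℝ) : Prop :=
  (∀ s ℓ, W s ℓ ∈ Sys.codebook) ∧
  (∀ k u, Sys.Θ * α k u ≤ ∑ s ∈ Finset.Iic u, ∑ ℓ,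
      (-‖G k s ℓ * B k s ℓ‖ ^ 2 - β k s ℓ + Real.log (S k s ℓ).det.re + (d : ℝ))) ∧
  (∀ k s ℓ, ‖(B k s ℓ)ᴴ * ((G k s ℓ)ᴴ * Sys.H k ℓ * W s ℓ - 1)‖ ^ 2 ≤ β k s ℓ) ∧
  (∀ k u, α k u ≤ 1)

/-- `W` is the precoder part of an optimal solution of the second-order cone program, which
maximizes `∑ k, ∑ u, μ k * α k u`. -/
def SOCPSolution {t : ℕ}
    (G : (k : Fin K) → Fin t → Fin L → Matrix (Fin (N k)) (Fin d) ℂ)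
    (S B : Fin K → Fin t → Fin L → Matrix (Fin d) (Fin d) ℂ)
    (W : FinSchedule L M d t) : Prop :=
  ∃ α β, Sys.SOCPFeasible G S B W α β ∧
    ∀ W' α' β', Sys.SOCPFeasible G S B W' α' β' →
      ∑ k, ∑ u, Sys.μ k * α' k u ≤ ∑ k, ∑ u, Sys.μ k * α k u

/-- One pass of the inner loop: from the precoders `W`, update the filters and the slack matrices,
then obtain the new precoders `W'` by solving the second-order cone program. -/
def InnerStep {t : ℕ} (W W' : FinSchedule L M d t) : Prop :=
  ∃ B : Fin K → Fin t → Fin L → Matrix (Fin d) (Fin d) ℂ,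
    (∀ k s ℓ, IsCholeskyFactor (Sys.slack k ℓ (W s ℓ)) (B k s ℓ)) ∧
    Sys.SOCPSolution (fun k s ℓ => Sys.lmmse k ℓ (W s ℓ)) (fun k s ℓ => Sys.slack k ℓ (W s ℓ)) B W'

/-- `W` is a result of the inner loop over `t` scheduling intervals: the limit, or an accumulation
point, of the iterates produced from some feasible initialization. -/
def InnerResult {t : ℕ} (W : FinSchedule L M d t) : Prop :=
  ∃ w : ℕ → FinSchedule L M d t,
    (∀ s ℓ, w 0 s ℓ ∈ Sys.codebook) ∧ (∀ i, Sys.InnerStep (w i) (w (i + 1))) ∧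
    MapClusterPt W atTop w

/-- `OuterState V t₀ t W`: the number of intervals `t` and the precoders `W` occur at the head of
the outer loop of the algorithm started with `t₀` intervals, where the feasible precoder set `V`
is given. Before the first pass nothing is transmitted. -/
inductive OuterState (V : Fin L → Matrix (Fin M) (Fin d) ℂ) (t₀ : ℕ) :
    (t : ℕ) → FinSchedule L M d t → Prop
  | init : OuterState V t₀ t₀ 0
  | pass {t : ℕ} {W : FinSchedule L M d t} {W' : FinSchedule L M d (t + 1)} :
      OuterState V t₀ t W →
      (∃ k, Sys.accRate W.extend k t < Sys.Θ - Sys.intervalRate k V) →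
      Sys.InnerResult W' → OuterState V t₀ (t + 1) W'

/-- `W` is an output of the algorithm upon termination, and it comprises `n` scheduling
intervals. -/
def IsOutput (V : Fin L → Matrix (Fin M) (Fin d) ℂ) (t₀ n : ℕ) (W : Schedule L M d) : Prop :=
  ∃ (t : ℕ) (X : FinSchedule L M d t), Sys.OuterState V t₀ t X ∧
    (∀ k, Sys.Θ - Sys.intervalRate k V ≤ Sys.accRate X.extend k t) ∧
    (((∀ k, Sys.Θ ≤ Sys.accRate X.extend k t) ∧ n = t ∧ W = X.extend) ∨
      ((∃ k, Sys.accRate X.extend k t < Sys.Θ) ∧ n = t + 1 ∧ W = X.augment V))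

end MulticastSystem

/-! ### The Frobenius norm and determinants -/

section MatrixFacts

open scoped ComplexOrder

variable {m n p r : Type*} [Fintype m] [Fintype n] [Fintype p] [Fintype r]

/-! The inner loop is a minorize-maximize scheme. The weighted mean square error identity gives, for
each base precoder, a concave quadratic minorant of the rate that is tight at the base point
(`wmseBound_le`, `wmseBound_self`). With `α` and `β` eliminated, the cone program maximizes the
utility of the accumulated minorants. Hence the utility increases along the iterates, and every
accumulation point maximizes the concave problem built at itself (`InnerResult.utility_le`); this
needs only continuity of the minorant in its base point, not convergence of the iterates.

Minimax duality for that concave problem yields the multipliers `lam`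
(`exists_multipliers_of_isMaxOn_sum_min`). Varying one slot at a time, and using that minorant and
rate have the same derivative at the base point, gives the power multipliers `δ` for the true rates
(`exists_multiplier_rate`). So the last pass ends at a KKT point of its finite horizon. If no pass
is made, the zero schedule is such a point, since every rate is minimal there.

Completing the schedule puts every user at or above the threshold from then on, so later indicators
equal one and their `lam` can be zero. Earlier tail sums do not change, later slots carry zero
weight, and only finitely many terms of the objective are nonzero (`IsFinKKT.isKKTPoint`). -/

theorem frobenius_norm_sq_eq_trace (A : Matrix m n ℂ) : ‖A‖ ^ 2 = (Aᴴ * A).trace.re := by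
  rw [Matrix.frobenius_norm_def, ← Real.sqrt_eq_rpow, Real.sq_sqrt (by positivity)]
  simp only [Matrix.trace, Matrix.diag_apply, Matrix.mul_apply, Matrix.conjTranspose_apply,
    Complex.re_sum, Real.rpow_two]
  rw [Finset.sum_comm]
  refine Finset.sum_congr rfl fun j _ => Finset.sum_congr rfl fun i _ => ?_
  rw [Complex.sq_norm, Complex.normSq_apply]
  simp

theorem differentiable_matrix_entry (i : m) (j : n) :
    Differentiable ℝ fun A : Matrix m n ℂ => A i j :=
  (LinearMap.toContinuousLinearMap (Matrix.entryLinearMap ℝ ℂ i j)).differentiable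

theorem differentiable_frobenius_norm_sq :
    Differentiable ℝ fun A : Matrix m n ℂ => ‖A‖ ^ 2 := by
  have h := differentiable_matrix_entry (m := m) (n := n)
  simp only [frobenius_norm_sq_eq_trace, Matrix.trace, Matrix.diag_apply, Matrix.mul_apply,
    Matrix.conjTranspose_apply, Complex.re_sum, Complex.star_def]
  have h' : ∀ i j, Differentiable ℝ fun A : Matrix m n ℂ => (star (A i j) * A i j).re := by
    intro i j
    exact Complex.reCLM.differentiable.comp (((h i j).star).mul (h i j))
  fun_prop

theorem differentiable_det_one_add_mul_conjTranspose [DecidableEq r] (H : Matrix r m ℂ) :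
    Differentiable ℝ fun A : Matrix m n ℂ => (1 + H * A * Aᴴ * Hᴴ).det.re := by
  have h := differentiable_matrix_entry (m := m) (n := n)
  have hs : ∀ i j, Differentiable ℝ fun A : Matrix m n ℂ => star (A i j) :=
    fun i j => (h i j).star
  refine Complex.reCLM.differentiable.comp (g := fun z : ℂ => z.re) ?_
  simp only [Matrix.det_apply, Matrix.mul_apply, Matrix.conjTranspose_apply, Matrix.add_apply]
  fun_prop

theorem posDef_one_add_conjTranspose_mul_self [DecidableEq n] (A : Matrix m n ℂ) : (1 + Aᴴ * A).PosDef :=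
  Matrix.PosDef.one.add_posSemidef (Matrix.posSemidef_conjTranspose_mul_self A)

theorem posDef_one_add_mul_conjTranspose_self [DecidableEq m] (A : Matrix m n ℂ) : (1 + A * Aᴴ).PosDef :=
  Matrix.PosDef.one.add_posSemidef (Matrix.posSemidef_self_mul_conjTranspose A)

variable [DecidableEq m] [DecidableEq n]

theorem Matrix.PosDef.det_re_pos {X : Matrix n n ℂ} (hX : X.PosDef) : 0 < X.det.re :=
  (Complex.pos_iff.1 hX.det_pos).1

/-- This is `log x ≤ x - 1` summed over the eigenvalues. -/
theorem Matrix.PosDef.log_det_re_le {X : Matrix n n ℂ} (hX : X.PosDef) :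
    Real.log X.det.re ≤ X.trace.re - Fintype.card n := by
  have hd : X.det.re = ∏ i, hX.1.eigenvalues i := by
    rw [hX.1.det_eq_prod_eigenvalues, ← Complex.ofReal_re (∏ i, hX.1.eigenvalues i)]
    push_cast
    rfl
  have ht : X.trace.re = ∑ i, hX.1.eigenvalues i := by
    rw [hX.1.trace_eq_sum_eigenvalues, Complex.re_sum]
    rfl
  rw [hd, ht, Real.log_prod fun i _ => (hX.eigenvalues_pos i).ne']
  calc ∑ i, Real.log (hX.1.eigenvalues i) ≤ ∑ i, (hX.1.eigenvalues i - 1) :=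
        Finset.sum_le_sum fun i _ => Real.log_le_sub_one_of_pos (hX.eigenvalues_pos i)
    _ = _ := by simp

open scoped MatrixOrder in
theorem Matrix.PosSemidef.exists_eq_mul_conjTranspose {S : Matrix n n ℂ} (hS : S.PosSemidef) :
    ∃ B : Matrix n n ℂ, S = B * Bᴴ := by
  obtain ⟨b, hb⟩ := CStarAlgebra.nonneg_iff_eq_star_mul_self.1 hS.nonneg
  exact ⟨bᴴ, by simpa [Matrix.star_eq_conjTranspose] using hb⟩

/-! ### Mean square error and the concave minorant of the log-determinant -/

theorem inv_one_add_conjTranspose_mul_self (A : Matrix m n ℂ) :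
    (1 + Aᴴ * A)⁻¹ = 1 - Aᴴ * (A * Aᴴ + 1)⁻¹ * A := by
  have hu : IsUnit (A * Aᴴ + 1).det := by
    rw [add_comm]
    exact (Matrix.isUnit_iff_isUnit_det _).1 (posDef_one_add_mul_conjTranspose_self A).isUnit
  refine Matrix.inv_eq_left_inv ?_
  -- The push-through identity, from which the inversion formula follows.
  have h1 : A * (1 + Aᴴ * A) = (A * Aᴴ + 1) * A := by
    simp only [Matrix.mul_add, Matrix.add_mul, Matrix.mul_one, Matrix.one_mul, Matrix.mul_assoc]
    rw [add_comm]
  rw [Matrix.sub_mul, Matrix.one_mul, Matrix.mul_assoc, h1, Matrix.mul_assoc Aᴴ,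
    Matrix.nonsing_inv_mul_cancel_left _ _ hu, add_sub_cancel_right]

/-- The mean square error matrix of the filter `G` splits into that of the optimal filter and a
positive semidefinite excess. -/
theorem mse_eq_inv_add (A G : Matrix m n ℂ) :
    (Gᴴ * A - 1) * (Gᴴ * A - 1)ᴴ + Gᴴ * G = (1 + Aᴴ * A)⁻¹ +
      (G - (A * Aᴴ + 1)⁻¹ * A)ᴴ * (A * Aᴴ + 1) * (G - (A * Aᴴ + 1)⁻¹ * A) := by
  have hu : IsUnit (A * Aᴴ + 1).det := by
    rw [add_comm]
    exact (Matrix.isUnit_iff_isUnit_det _).1 (posDef_one_add_mul_conjTranspose_self A).isUnit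
  have hQ : (A * Aᴴ + 1)ᴴ = A * Aᴴ + 1 := by simp
  rw [inv_one_add_conjTranspose_mul_self]
  set Q := A * Aᴴ + 1 with hQdef
  have e1 : Q * (G - Q⁻¹ * A) = Q * G - A := by
    rw [Matrix.mul_sub, Matrix.mul_nonsing_inv_cancel_left _ _ hu]
  have e2 : (G - Q⁻¹ * A)ᴴ = Gᴴ - Aᴴ * Q⁻¹ := by
    rw [Matrix.conjTranspose_sub, Matrix.conjTranspose_mul, Matrix.conjTranspose_nonsing_inv, hQ]
  have e3 : (Gᴴ - Aᴴ * Q⁻¹) * (Q * G - A) =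
      Gᴴ * (Q * G) - Gᴴ * A - (Aᴴ * G - Aᴴ * Q⁻¹ * A) := by
    rw [Matrix.sub_mul, Matrix.mul_sub, Matrix.mul_sub, Matrix.mul_assoc Aᴴ Q⁻¹ (Q * G),
      Matrix.nonsing_inv_mul_cancel_left _ _ hu]
  rw [Matrix.mul_assoc _ Q, e1, e2, e3]
  generalize Aᴴ * Q⁻¹ * A = Z
  rw [hQdef]
  simp only [Matrix.conjTranspose_sub, Matrix.conjTranspose_mul, Matrix.conjTranspose_conjTranspose,
    Matrix.conjTranspose_one, Matrix.sub_mul, Matrix.mul_sub, Matrix.add_mul, Matrix.mul_add,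
    Matrix.mul_one, Matrix.one_mul, Matrix.mul_assoc]
  abel

/-- The lower bound on `log |1 + A Aᴴ|` given by the weighted mean square error, whose filter and
weight are the optimal ones for `A₀`. -/
noncomputable def wmseBound (A₀ A : Matrix m n ℂ) : ℝ :=
  Real.log (1 + A₀ᴴ * A₀).det.re + Fintype.card n -
    ((1 + A₀ᴴ * A₀) * ((((A₀ * A₀ᴴ + 1)⁻¹ * A₀)ᴴ * A - 1) * (((A₀ * A₀ᴴ + 1)⁻¹ * A₀)ᴴ * A - 1)ᴴ +
      ((A₀ * A₀ᴴ + 1)⁻¹ * A₀)ᴴ * ((A₀ * A₀ᴴ + 1)⁻¹ * A₀))).trace.re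

/-- The filter is optimal for `A` itself, so the excess error vanishes and the trace term is exactly
the size of the identity. -/
theorem wmseBound_self (A : Matrix m n ℂ) :
    wmseBound A A = Real.log (1 + A * Aᴴ).det.re := by
  rw [wmseBound, mse_eq_inv_add, sub_self, Matrix.mul_zero, add_zero, Matrix.mul_nonsing_inv,
    Matrix.trace_one, Matrix.det_one_add_mul_comm A]
  · simp
  · exact (Matrix.isUnit_iff_isUnit_det _).1 (posDef_one_add_conjTranspose_mul_self A).isUnit

/-- With `S = 1 + A₀ᴴ A₀` and `Y = 1 + Aᴴ A`, dropping the excess error leaves `log det S + n - tr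
(S Y⁻¹)`, which is at most `log det Y` by `log det X ≤ tr X - n`. -/
theorem wmseBound_le (A₀ A : Matrix m n ℂ) :
    wmseBound A₀ A ≤ Real.log (1 + A * Aᴴ).det.re := by
  have hS := posDef_one_add_conjTranspose_mul_self A₀
  have hY := posDef_one_add_conjTranspose_mul_self A
  obtain ⟨B, hB⟩ := hS.posSemidef.exists_eq_mul_conjTranspose
  have hQ : (A * Aᴴ + 1).PosSemidef := by
    rw [add_comm]
    exact (posDef_one_add_mul_conjTranspose_self A).posSemidef
  have hdS : (1 + A₀ᴴ * A₀).det = B.det * Bᴴ.det := by rw [hB, Matrix.det_mul]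
  have hBu : IsUnit B := by
    rw [Matrix.isUnit_iff_isUnit_det, isUnit_iff_ne_zero]
    intro h0
    rw [h0, zero_mul] at hdS
    exact hS.det_pos.ne' hdS
  -- The product `S Y⁻¹` need not be Hermitian; this matrix is, with the same trace and determinant.
  have hX : (Bᴴ * (1 + Aᴴ * A)⁻¹ * B).PosDef :=
    hY.inv.conjTranspose_mul_mul_same (Matrix.mulVec_injective_iff_isUnit.2 hBu)
  have hdet : (Bᴴ * (1 + Aᴴ * A)⁻¹ * B).det.re =
      (1 + A₀ᴴ * A₀).det.re * ((1 + Aᴴ * A).det.re)⁻¹ := by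
    have h1 : (Bᴴ * (1 + Aᴴ * A)⁻¹ * B).det = (1 + A₀ᴴ * A₀).det * ((1 + Aᴴ * A).det)⁻¹ := by
      rw [Matrix.det_mul, Matrix.det_mul, hdS, Matrix.det_nonsing_inv, Ring.inverse_eq_inv']
      ring
    have hr : ∀ {X : Matrix n n ℂ}, X.PosDef → X.det = (X.det.re : ℂ) := fun {X} hX =>
      Complex.ext rfl (by simpa using (Complex.pos_iff.1 hX.det_pos).2.symm)
    rw [h1, hr hS, hr hY, ← Complex.ofReal_inv, ← Complex.ofReal_mul]
    simp only [Complex.ofReal_re]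
  have hlog := hX.log_det_re_le
  rw [hdet, Real.log_mul hS.det_re_pos.ne' (inv_ne_zero hY.det_re_pos.ne'), Real.log_inv] at hlog
  rw [wmseBound, mse_eq_inv_add, Matrix.det_one_add_mul_comm A]
  generalize (A₀ * A₀ᴴ + 1)⁻¹ * A₀ - (A * Aᴴ + 1)⁻¹ * A = D
  have hD : 0 ≤ ((Bᴴ * (Dᴴ * (A * Aᴴ + 1) * D) * B).trace).re :=
    (Complex.nonneg_iff.1 ((hQ.conjTranspose_mul_mul_same D).conjTranspose_mul_mul_same
      B).trace_nonneg).1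
  have htr : ∀ Z : Matrix n n ℂ, ((1 + A₀ᴴ * A₀) * Z).trace = (Bᴴ * Z * B).trace := fun Z => by
    rw [hB, Matrix.mul_assoc, Matrix.trace_mul_comm]
  rw [Matrix.mul_add, Matrix.trace_add, htr, htr, Complex.add_re]
  linarith

theorem wmseBound_eq_norm {A₀ : Matrix m n ℂ} {B : Matrix n n ℂ} (hB : 1 + A₀ᴴ * A₀ = B * Bᴴ)
    (A : Matrix m n ℂ) :
    wmseBound A₀ A = Real.log (1 + A₀ᴴ * A₀).det.re + Fintype.card n -
      ‖(A₀ * A₀ᴴ + 1)⁻¹ * A₀ * B‖ ^ 2 - ‖Bᴴ * (((A₀ * A₀ᴴ + 1)⁻¹ * A₀)ᴴ * A - 1)‖ ^ 2 := by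
  rw [wmseBound]
  generalize (A₀ * A₀ᴴ + 1)⁻¹ * A₀ = G
  rw [Matrix.mul_add, Matrix.trace_add, Complex.add_re,
    ← Matrix.frobenius_norm_conjTranspose (Bᴴ * (Gᴴ * A - 1)),
    frobenius_norm_sq_eq_trace, frobenius_norm_sq_eq_trace, Matrix.conjTranspose_conjTranspose, hB]
  have e1 : ((G * B)ᴴ * (G * B)).trace = (B * Bᴴ * (Gᴴ * G)).trace := by
    rw [Matrix.conjTranspose_mul, Matrix.mul_assoc, Matrix.mul_assoc B, Matrix.trace_mul_comm B]
    simp only [Matrix.mul_assoc]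
  have e2 : (Bᴴ * (Gᴴ * A - 1) * (Bᴴ * (Gᴴ * A - 1))ᴴ).trace =
      (B * Bᴴ * ((Gᴴ * A - 1) * (Gᴴ * A - 1)ᴴ)).trace := by
    rw [Matrix.conjTranspose_mul, Matrix.conjTranspose_conjTranspose, Matrix.mul_assoc B,
      Matrix.trace_mul_comm B]
    simp only [Matrix.mul_assoc]
  rw [e1, e2]
  ring

/-- Continuity in the base point is what survives the passage to an accumulation point of the
iterates. -/
theorem continuous_wmseBound_left (A : Matrix m n ℂ) :
    Continuous fun A₀ : Matrix m n ℂ => wmseBound A₀ A := by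
  have hinv : Continuous fun A₀ : Matrix m n ℂ => (A₀ * A₀ᴴ + 1)⁻¹ := by
    have hd : ∀ A₀ : Matrix m n ℂ, (A₀ * A₀ᴴ + 1).det ≠ 0 := fun A₀ => by
      rw [add_comm]
      exact (posDef_one_add_mul_conjTranspose_self A₀).det_pos.ne'
    simp only [Matrix.inv_def, Ring.inverse_eq_inv']
    have h1 : Continuous fun A₀ : Matrix m n ℂ => A₀ * A₀ᴴ + 1 := by fun_prop
    exact (h1.matrix_det.inv₀ hd).smul h1.matrix_adjugate
  have hlog : Continuous fun A₀ : Matrix m n ℂ => Real.log (1 + A₀ᴴ * A₀).det.re := by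
    refine Continuous.log (by fun_prop) fun A₀ => ?_
    exact (posDef_one_add_conjTranspose_mul_self A₀).det_re_pos.ne'
  unfold wmseBound
  fun_prop

/-- A constant minus the squared norm of an affine map: concavity, continuity and differentiability
in `A` are read off from this form. -/
theorem exists_wmseBound_eq_sub_norm_sq (A₀ : Matrix m n ℂ) : ∃ (c : ℝ) (B : Matrix n n ℂ)
    (G : Matrix n m ℂ), ∀ A, wmseBound A₀ A = c - ‖Bᴴ * (G * A - 1)‖ ^ 2 := by
  obtain ⟨B, hB⟩ :=
    (posDef_one_add_conjTranspose_mul_self A₀).posSemidef.exists_eq_mul_conjTranspose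
  exact ⟨_, B, _, fun A => wmseBound_eq_norm hB A⟩

theorem concaveOn_wmseBound_mul (A₀ : Matrix m n ℂ) (H : Matrix m p ℂ) :
    ConcaveOn ℝ Set.univ fun A : Matrix p n ℂ => wmseBound A₀ (H * A) := by
  obtain ⟨c, B, G, h⟩ := exists_wmseBound_eq_sub_norm_sq A₀
  simp only [h]
  refine (concaveOn_const c convex_univ).sub ⟨convex_univ, fun X _ Y _ a b ha hb hab => ?_⟩
  have key : Bᴴ * (G * (H * (a • X + b • Y)) - 1) =
      a • (Bᴴ * (G * (H * X) - 1)) + b • (Bᴴ * (G * (H * Y) - 1)) := by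
    have h1 : (1 : Matrix n n ℂ) = a • 1 + b • 1 := by rw [← add_smul, hab, one_smul]
    conv_lhs => rw [h1]
    simp only [Matrix.mul_add, Matrix.mul_sub, Matrix.mul_smul, smul_sub]
    abel
  have hc := ((convexOn_univ_norm (E := Matrix n n ℂ)).pow (fun _ _ => norm_nonneg _) 2).2
    (Set.mem_univ (Bᴴ * (G * (H * X) - 1))) (Set.mem_univ (Bᴴ * (G * (H * Y) - 1))) ha hb hab
  simpa [key] using hc

theorem continuous_wmseBound_mul (A₀ : Matrix m n ℂ) (H : Matrix m p ℂ) :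
    Continuous fun A : Matrix p n ℂ => wmseBound A₀ (H * A) := by
  obtain ⟨c, B, G, h⟩ := exists_wmseBound_eq_sub_norm_sq A₀
  simp only [h]
  fun_prop

theorem differentiable_wmseBound_mul (A₀ : Matrix m n ℂ) (H : Matrix m p ℂ) :
    Differentiable ℝ fun A : Matrix p n ℂ => wmseBound A₀ (H * A) := by
  obtain ⟨c, B, G, h⟩ := exists_wmseBound_eq_sub_norm_sq A₀
  simp only [h]
  let φ : Matrix p n ℂ →ₗ[ℝ] Matrix n n ℂ :=
    { toFun := fun A => Bᴴ * (G * (H * A))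
      map_add' := fun X Y => by simp only [Matrix.mul_add]
      map_smul' := fun a X => by simp }
  have hφ : Differentiable ℝ φ := (LinearMap.toContinuousLinearMap φ).differentiable
  have hq : ∀ A, ‖Bᴴ * (G * (H * A) - 1)‖ ^ 2 = (fun X => ‖X‖ ^ 2) (φ A - Bᴴ) := fun A => by
    simp [φ, Matrix.mul_sub]
  simp only [hq]
  exact (differentiable_const c).sub
    (differentiable_frobenius_norm_sq.comp (f := fun A => φ A - Bᴴ)
      (hφ.sub (differentiable_const _)))

end MatrixFacts

/-! ### Multipliers -/

/-- A maximizer of `∑ i, μ i * min (a i / Θ) 1` with concave `a i` over a compact convex set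
maximizes `∑ i, lam i * a i` for multipliers `lam` of the constraints `Θ * α i ≤ a i`. -/
theorem exists_multipliers_of_isMaxOn_sum_min {ι E : Type*} [Fintype ι] [TopologicalSpace E]
    [AddCommGroup E] [Module ℝ E] [IsTopologicalAddGroup E] [ContinuousSMul ℝ E] {C : Set E}
    (hC : Convex ℝ C) (hCc : IsCompact C) {a : ι → E → ℝ} (ha : ∀ i, ConcaveOn ℝ C (a i))
    (hac : ∀ i, ContinuousOn (a i) C) {μ : ι → ℝ} (hμ : ∀ i, 0 ≤ μ i) {Θ : ℝ} (hΘ : 0 < Θ)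
    {w : E} (hw : w ∈ C)
    (hmax : ∀ z ∈ C, ∑ i, μ i * min (a i z / Θ) 1 ≤ ∑ i, μ i * min (a i w / Θ) 1) :
    ∃ lam : ι → ℝ, (∀ i, 0 ≤ lam i ∧ 0 ≤ μ i - Θ * lam i ∧
      lam i * (Θ * min (a i w / Θ) 1 - a i w) = 0 ∧
      (μ i - Θ * lam i) * (min (a i w / Θ) 1 - 1) = 0) ∧
      ∀ z ∈ C, ∑ i, lam i * a i z ≤ ∑ i, lam i * a i w := by
  have hmin₁ : ∀ i z, 0 ≤ a i z - Θ * min (a i z / Θ) 1 := fun i z => by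
    have := mul_le_mul_of_nonneg_left (min_le_left (a i z / Θ) 1) hΘ.le
    rw [mul_div_cancel₀ _ hΘ.ne'] at this
    linarith
  have hmin₂ : ∀ i z, 0 ≤ 1 - min (a i z / Θ) 1 := fun i z => sub_nonneg.2 (min_le_right _ _)
  set X : Set (ι → ℝ) := Set.Icc 0 fun i => μ i / Θ with hX
  -- The box encodes `lam ≥ 0` and `nu = μ - Θ lam ≥ 0`.
  have hXle : ∀ l ∈ X, ∀ i, 0 ≤ l i ∧ 0 ≤ μ i - Θ * l i := fun l hl i => by
    refine ⟨hl.1 i, ?_⟩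
    have := hl.2 i
    rw [le_div_iff₀ hΘ] at this
    linarith
  -- The Lagrangian; with `nu = μ - Θ lam` the variables `α` cancel.
  let f : (ι → ℝ) → E → ℝ := fun l z => ∑ i, (l i * a i z + (μ i - Θ * l i))
  -- The Lagrangian exceeds the objective by precisely the complementary slackness products.
  have hf : ∀ l z, f l z = ∑ i, μ i * min (a i z / Θ) 1 +
      ∑ i, (l i * (a i z - Θ * min (a i z / Θ) 1) +
        (μ i - Θ * l i) * (1 - min (a i z / Θ) 1)) := fun l z => by
    rw [← Finset.sum_add_distrib]
    exact Finset.sum_congr rfl fun i _ => by ring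
  have hlow : ∀ l ∈ X, ∀ z i, 0 ≤ l i * (a i z - Θ * min (a i z / Θ) 1) +
        (μ i - Θ * l i) * (1 - min (a i z / Θ) 1) := fun l hl z i =>
    add_nonneg (mul_nonneg (hXle l hl i).1 (hmin₁ i z)) (mul_nonneg (hXle l hl i).2 (hmin₂ i z))
  -- Each summand is affine in `l i`, so its minimum over the box sits at an endpoint, chosen by the
  -- side of `Θ` on which `a i z` lies.
  have hatt : ∀ z, ∃ l ∈ X, f l z = ∑ i, μ i * min (a i z / Θ) 1 := fun z => by
    refine ⟨fun i => if a i z < Θ then μ i / Θ else 0, ⟨fun i => ?_, fun i => ?_⟩, ?_⟩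
    · dsimp only
      split_ifs
      exacts [div_nonneg (hμ i) hΘ.le, le_rfl]
    · dsimp only
      split_ifs
      exacts [le_rfl, div_nonneg (hμ i) hΘ.le]
    · refine Finset.sum_congr rfl fun i _ => ?_
      dsimp only
      split_ifs with h
      · rw [min_eq_left ((div_le_one hΘ).2 h.le)]
        field_simp
        ring
      · rw [min_eq_right ((one_le_div hΘ).2 (not_lt.1 h))]
        ring
  -- The multiplier box is compact, so a saddle point exists without a Slater condition.
  obtain ⟨l, hl, z₀, hz₀, hs⟩ := Sion.exists_isSaddlePointOn (E := ι → ℝ) (F := E) (X := X)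
    (Y := C) (f := f) ⟨0, le_rfl, fun i => div_nonneg (hμ i) hΘ.le⟩ (convex_Icc _ _) isCompact_Icc
    (fun z _ => Continuous.lowerSemicontinuous (by fun_prop) |>.lowerSemicontinuousOn _)
    (fun z _ => by
      refine ConvexOn.quasiconvexOn ⟨convex_Icc _ _, fun x _ y _ s t _ _ hst => ?_⟩
      simp only [f, smul_eq_mul, Finset.mul_sum, ← Finset.sum_add_distrib, Pi.add_apply,
        Pi.smul_apply]
      refine (Finset.sum_congr rfl fun i _ => ?_).le
      have : s = 1 - t := by linarith
      subst this
      ring)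
    hC ⟨w, hw⟩ hCc
    (fun l _ => ContinuousOn.upperSemicontinuousOn (by fun_prop))
    (fun l hl => by
      refine ConcaveOn.quasiconcaveOn ⟨hC, fun x hx y hy s t hs ht hst => ?_⟩
      simp only [f, smul_eq_mul, Finset.mul_sum, ← Finset.sum_add_distrib]
      refine Finset.sum_le_sum fun i _ => ?_
      have h1 := mul_le_mul_of_nonneg_left ((ha i).2 hx hy hs ht hst) (hXle l hl i).1
      simp only [smul_eq_mul] at h1
      have : s = 1 - t := by linarith
      subst this
      linarith)
  -- The saddle point `z₀` may differ from `w`, but its value is no larger than the optimal value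
  -- attained at `w`.
  have hz : ∀ z ∈ C, f l z ≤ ∑ i, μ i * min (a i w / Θ) 1 := fun z hz => by
    obtain ⟨l', hl', he⟩ := hatt z₀
    exact (hs l' hl' z hz).trans (he.trans_le (hmax z₀ hz₀))
  have hsum : ∑ i, (l i * (a i w - Θ * min (a i w / Θ) 1) +
        (μ i - Θ * l i) * (1 - min (a i w / Θ) 1)) = 0 := by
    refine le_antisymm ?_ (Finset.sum_nonneg fun i _ => hlow l hl w i)
    have := hz w hw
    rw [hf] at this
    linarith
  refine ⟨l, fun i => ⟨(hXle l hl i).1, (hXle l hl i).2, ?_⟩, fun z hzC => ?_⟩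
  · have hi := (Finset.sum_eq_zero_iff_of_nonneg fun i _ => hlow l hl w i).1 hsum i
      (Finset.mem_univ i)
    have h1 := mul_nonneg (hXle l hl i).1 (hmin₁ i w)
    have h2 := mul_nonneg (hXle l hl i).2 (hmin₂ i w)
    constructor <;> linarith
  · have h1 := hz z hzC
    have h2 := hf l w
    rw [hsum, add_zero] at h2
    rw [← h2] at h1
    simp only [f, Finset.sum_add_distrib] at h1
    linarith

/-! ### First-order conditions under one inequality constraint -/

theorem HasFDerivAt.apply_nonpos_of_eventually_le {E : Type*} [NormedAddCommGroup E]
    [NormedSpace ℝ E] {h : E → ℝ} {h' : E →L[ℝ] ℝ} {w v : E} (hh : HasFDerivAt h h' w)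
    (hle : ∀ᶠ ε : ℝ in 𝓝[>] 0, h (w + ε • v) ≤ h w) : h' v ≤ 0 := by
  refine le_of_tendsto (hh.hasLineDerivAt v).tendsto_slope_zero_right ?_
  filter_upwards [hle, self_mem_nhdsWithin] with ε hε hpos
  exact mul_nonpos_of_nonneg_of_nonpos (inv_nonneg.2 (le_of_lt hpos)) (sub_nonpos.2 hε)

/-- The multiplier rule for one inequality constraint `q ≤ c` whose derivative does not vanish
where the constraint is active. -/
theorem exists_multiplier_of_isMaxOn {E : Type*} [NormedAddCommGroup E] [NormedSpace ℝ E]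
    {h q : E → ℝ} {h' q' : E →L[ℝ] ℝ} {w v : E} {c : ℝ} (hh : HasFDerivAt h h' w)
    (hq : HasFDerivAt q q' w) (hw : q w ≤ c) (hv : q w = c → 0 < q' v)
    (hmax : ∀ z, q z ≤ c → h z ≤ h w) :
    ∃ δ : ℝ, 0 ≤ δ ∧ δ * (q w - c) = 0 ∧ h' = δ • q' := by
  rcases hw.lt_or_eq with hlt | heq
  · refine ⟨0, le_rfl, zero_mul _, ?_⟩
    rw [zero_smul]
    refine IsLocalMax.hasFDerivAt_eq_zero ?_ hh
    filter_upwards [hq.continuousAt.eventually_lt continuousAt_const hlt] with z hz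
    exact hmax z hz.le
  have hv := hv heq
  -- A direction that strictly decreases `q` stays feasible for small steps.
  have hneg : ∀ u, q' u < 0 → h' u ≤ 0 := fun u hu => by
    refine hh.apply_nonpos_of_eventually_le ?_
    filter_upwards [(hq.hasLineDerivAt u).tendsto_slope_zero_right.eventually_lt_const hu,
      self_mem_nhdsWithin] with ε hε hpos
    refine hmax _ ?_
    by_contra! hc
    exact hε.not_ge (mul_nonneg (inv_nonneg.2 (le_of_lt hpos)) (by linarith))
  have hnonpos : ∀ u, q' u ≤ 0 → h' u ≤ 0 := fun u hu => by
    by_contra! hc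
    -- Tilting `u` by a small multiple of `-v` makes it strictly inward; the size keeps `h'` at
    -- least `h' u / 2`, and the `+ 1` avoids division by zero.
    have h1 := hneg (u - (h' u / (|h' v| + 1) / 2) • v) (by
      have : 0 < h' u / (|h' v| + 1) / 2 := by positivity
      simp only [map_sub, map_smul, smul_eq_mul]
      nlinarith)
    simp only [map_sub, map_smul, smul_eq_mul] at h1
    have h2 : h' u / (|h' v| + 1) / 2 * h' v ≤ h' u / (|h' v| + 1) / 2 * (|h' v| + 1) :=
      mul_le_mul_of_nonneg_left (by linarith [le_abs_self (h' v)]) (by positivity)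
    have h3 : h' u / (|h' v| + 1) / 2 * (|h' v| + 1) = h' u / 2 := by
      field_simp
    linarith
  refine ⟨h' v / q' v, ?_, by rw [heq, sub_self, mul_zero], ?_⟩
  · have := hnonpos (-v) (by simpa using hv.le)
    rw [map_neg] at this
    exact div_nonneg (by linarith) hv.le
  · ext u
    -- Project `u` along `v` onto the kernel of `q'`; both signs of the projection are admissible,
    -- so `h'` vanishes on it.
    have h0 : q' (u - (q' u / q' v) • v) = 0 := by
      simp only [map_sub, map_smul, smul_eq_mul]
      field_simp
      ring
    have h1 := hnonpos _ h0.le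
    have h2 := hnonpos (-(u - (q' u / q' v) • v)) (by rw [map_neg, h0, neg_zero])
    rw [map_neg] at h2
    simp only [map_sub, map_smul, smul_eq_mul] at h1 h2
    have h3 : h' u = q' u / q' v * h' v := by linarith
    rw [h3, _root_.smul_apply, smul_eq_mul]
    ring

/-- Euler's identity for a homogeneous function of degree two. It makes the active power constraint
regular in the radial direction. -/
theorem HasFDerivAt.norm_sq_apply_self {E : Type*} [NormedAddCommGroup E] [NormedSpace ℝ E]
    {w : E} {q' : E →L[ℝ] ℝ} (hq : HasFDerivAt (fun v : E => ‖v‖ ^ 2) q' w) :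
    q' w = 2 * ‖w‖ ^ 2 := by
  have hl : HasDerivAt (fun ε : ℝ => ε • w) w 1 := by
    simpa using (hasDerivAt_id (1 : ℝ)).smul_const w
  have h0 : HasFDerivAt (fun v : E => ‖v‖ ^ 2) q' ((1 : ℝ) • w) := by simpa using hq
  have h1 := h0.comp_hasDerivAt (1 : ℝ) hl
  have h2 : HasDerivAt (fun ε : ℝ => ε ^ 2 * ‖w‖ ^ 2) (2 * ‖w‖ ^ 2) 1 := by
    simpa using ((hasDerivAt_id (1 : ℝ)).pow 2).mul_const (‖w‖ ^ 2)
  refine h1.unique (h2.congr_of_eventuallyEq (Filter.Eventually.of_forall fun ε => ?_))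
  simp [norm_smul, mul_pow]

namespace MulticastSystem

variable {K L M d : ℕ} {N : Fin K → ℕ} (Sys : MulticastSystem K L M d N)

/-! ### The rates and their lower bounds -/

theorem rate_eq (k : Fin K) (ℓ : Fin L) (W : Matrix (Fin M) (Fin d) ℂ) :
    Sys.rate k ℓ W = Real.log (1 + Sys.H k ℓ * W * (Sys.H k ℓ * W)ᴴ).det.re := by
  simp only [rate, Matrix.conjTranspose_mul, Matrix.mul_assoc]

/-- The concave lower bound on the rate that underlies the second-order cone program. -/
noncomputable def surrogate (k : Fin K) (ℓ : Fin L) (W₀ W : Matrix (Fin M) (Fin d) ℂ) : ℝ :=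
  wmseBound (Sys.H k ℓ * W₀) (Sys.H k ℓ * W)

theorem surrogate_self (k : Fin K) (ℓ : Fin L) (W : Matrix (Fin M) (Fin d) ℂ) :
    Sys.surrogate k ℓ W W = Sys.rate k ℓ W := by
  rw [surrogate, wmseBound_self, rate_eq]

theorem surrogate_le_rate (k : Fin K) (ℓ : Fin L) (W₀ W : Matrix (Fin M) (Fin d) ℂ) :
    Sys.surrogate k ℓ W₀ W ≤ Sys.rate k ℓ W := by
  rw [rate_eq]
  exact wmseBound_le _ _

/-- Identifies the minorant with the summand of the cone program when `β` takes its least admissible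
value. -/
theorem surrogate_eq {k : Fin K} {ℓ : Fin L} {W₀ : Matrix (Fin M) (Fin d) ℂ}
    {B : Matrix (Fin d) (Fin d) ℂ} (hB : Sys.slack k ℓ W₀ = B * Bᴴ)
    (W : Matrix (Fin M) (Fin d) ℂ) :
    Sys.surrogate k ℓ W₀ W = -‖Sys.lmmse k ℓ W₀ * B‖ ^ 2
      - ‖Bᴴ * ((Sys.lmmse k ℓ W₀)ᴴ * Sys.H k ℓ * W - 1)‖ ^ 2
      + Real.log (Sys.slack k ℓ W₀).det.re + d := by
  have hS : Sys.slack k ℓ W₀ = 1 + (Sys.H k ℓ * W₀)ᴴ * (Sys.H k ℓ * W₀) := by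
    rw [slack, add_comm]
    simp only [Matrix.conjTranspose_mul, Matrix.mul_assoc]
  have hG : Sys.lmmse k ℓ W₀ =
      (Sys.H k ℓ * W₀ * (Sys.H k ℓ * W₀)ᴴ + 1)⁻¹ * (Sys.H k ℓ * W₀) := by
    simp only [lmmse, Matrix.conjTranspose_mul, Matrix.mul_assoc]
  rw [surrogate, wmseBound_eq_norm (hS ▸ hB), ← hS, ← hG, Matrix.mul_assoc _ (Sys.H k ℓ),
    Fintype.card_fin]
  ring

theorem rate_zero (k : Fin K) (ℓ : Fin L) : Sys.rate k ℓ 0 = 0 := by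
  simp [rate]

theorem rate_nonneg (k : Fin K) (ℓ : Fin L) (W : Matrix (Fin M) (Fin d) ℂ) :
    0 ≤ Sys.rate k ℓ W := by
  -- The minorant with base point `0` is identically zero.
  refine le_trans (le_of_eq ?_) (Sys.surrogate_le_rate k ℓ 0 W)
  simp [surrogate, wmseBound]

theorem differentiable_rate (k : Fin K) (ℓ : Fin L) : Differentiable ℝ (Sys.rate k ℓ) := by
  refine (differentiable_det_one_add_mul_conjTranspose (Sys.H k ℓ)).log fun W => ?_
  have h := posDef_one_add_mul_conjTranspose_self (Sys.H k ℓ * W)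
  rw [Matrix.conjTranspose_mul, ← Matrix.mul_assoc] at h
  exact h.det_re_pos.ne'

theorem continuous_rate (k : Fin K) (ℓ : Fin L) : Continuous (Sys.rate k ℓ) :=
  (Sys.differentiable_rate k ℓ).continuous

theorem continuous_surrogate_left (k : Fin K) (ℓ : Fin L) (W : Matrix (Fin M) (Fin d) ℂ) :
    Continuous fun W₀ => Sys.surrogate k ℓ W₀ W :=
  (continuous_wmseBound_left (Sys.H k ℓ * W)).comp
    (by fun_prop : Continuous fun W₀ : Matrix (Fin M) (Fin d) ℂ => Sys.H k ℓ * W₀)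

/-! ### The codebook -/

theorem isClosed_codebook : IsClosed (Sys.codebook (L := L) (M := M) (d := d)) :=
  isClosed_le (by fun_prop) continuous_const

theorem isCompact_codebook : IsCompact (Sys.codebook (L := L) (M := M) (d := d)) := by
  have : ProperSpace (Matrix (Fin M) (Fin d) ℂ) := FiniteDimensional.proper ℝ _
  refine Metric.isCompact_of_isClosed_isBounded Sys.isClosed_codebook ?_
  refine (Metric.isBounded_closedBall (x := 0) (r := √Sys.P)).subset fun W hW => ?_
  rw [mem_closedBall_zero_iff]
  exact (le_abs_self _).trans (Real.abs_le_sqrt hW)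

theorem convex_codebook : Convex ℝ (Sys.codebook (L := L) (M := M) (d := d)) := by
  have h := ((convexOn_univ_norm (E := Matrix (Fin M) (Fin d) ℂ)).pow
    (fun _ _ => norm_nonneg _) 2).convex_le Sys.P
  simpa [codebook] using h

/-- The feasible precoders for `t` scheduling intervals. -/
def finFeasible (t : ℕ) : Set (FinSchedule L M d t) := {W | ∀ s ℓ, W s ℓ ∈ Sys.codebook}

theorem finFeasible_eq (t : ℕ) : Sys.finFeasible t =
    Set.pi Set.univ fun _ : Fin t => Set.pi Set.univ fun _ : Fin L => Sys.codebook := by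
  ext W
  simp [finFeasible]

theorem isCompact_finFeasible (t : ℕ) : IsCompact (Sys.finFeasible t) := by
  rw [finFeasible_eq]
  exact isCompact_univ_pi fun _ => isCompact_univ_pi fun _ => Sys.isCompact_codebook

theorem convex_finFeasible (t : ℕ) : Convex ℝ (Sys.finFeasible t) := by
  rw [finFeasible_eq]
  exact convex_pi fun _ _ => convex_pi fun _ _ => Sys.convex_codebook

/-! ### The inner loop -/

/-- The lower bound on the accumulated rate for the precoders `Z` that is tight at `W`. -/
noncomputable def accSurrogate {t : ℕ} (W Z : FinSchedule L M d t) (k : Fin K) (u : Fin t) : ℝ :=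
  ∑ s ∈ Finset.Iic u, ∑ ℓ, Sys.surrogate k ℓ (W s ℓ) (Z s ℓ)

/-- The weighted sum of the relaxed indicators at the accumulated rates `a`. -/
noncomputable def utility {t : ℕ} (a : Fin K → Fin t → ℝ) : ℝ :=
  ∑ k, ∑ u, Sys.μ k * min (a k u / Sys.Θ) 1

theorem utility_mono (hΘ : 0 < Sys.Θ) (hμ : ∀ k, 0 ≤ Sys.μ k) {t : ℕ} {a b : Fin K → Fin t → ℝ}
    (hab : ∀ k u, a k u ≤ b k u) : Sys.utility a ≤ Sys.utility b :=
  Finset.sum_le_sum fun k _ => Finset.sum_le_sum fun u _ =>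
    mul_le_mul_of_nonneg_left
      (min_le_min_right _ (div_le_div_of_nonneg_right (hab k u) hΘ.le)) (hμ k)

variable {Sys}

theorem InnerStep.mem_finFeasible {t : ℕ} {W W' : FinSchedule L M d t}
    (h : Sys.InnerStep W W') : W' ∈ Sys.finFeasible t := by
  obtain ⟨B, -, α, β, hf, -⟩ := h
  exact hf.1

theorem InnerStep.utility_le (hΘ : 0 < Sys.Θ) (hμ : ∀ k, 0 ≤ Sys.μ k) {t : ℕ}
    {W W' Z : FinSchedule L M d t} (h : Sys.InnerStep W W') (hZ : Z ∈ Sys.finFeasible t) :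
    Sys.utility (Sys.accSurrogate W Z) ≤ Sys.utility (Sys.accSurrogate W W') := by
  obtain ⟨B, hB, α, β, ⟨-, hα, hβ, hα1⟩, hopt⟩ := h
  -- For fixed `Z` the best choice is the least `β` and the largest `α`, so the program reduces to
  -- maximizing the utility of the minorants.
  refine (hopt Z (fun k u => min (Sys.accSurrogate W Z k u / Sys.Θ) 1)
    (fun k s ℓ => ‖(B k s ℓ)ᴴ * ((Sys.lmmse k ℓ (W s ℓ))ᴴ * Sys.H k ℓ * Z s ℓ - 1)‖ ^ 2)
    ⟨hZ, fun k u => ?_, fun k s ℓ => le_rfl, fun k u => min_le_right _ _⟩).trans ?_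
  · refine (mul_le_mul_of_nonneg_left (min_le_left _ _) hΘ.le).trans ?_
    rw [mul_div_cancel₀ _ hΘ.ne']
    exact Finset.sum_le_sum fun s _ => Finset.sum_le_sum fun ℓ _ =>
      (Sys.surrogate_eq (hB k s ℓ).1 (Z s ℓ)).le
  · refine Finset.sum_le_sum fun k _ => Finset.sum_le_sum fun u _ =>
      mul_le_mul_of_nonneg_left (le_min ?_ (hα1 k u)) (hμ k)
    rw [le_div_iff₀ hΘ, mul_comm]
    refine (hα k u).trans (Finset.sum_le_sum fun s _ => Finset.sum_le_sum fun ℓ _ => ?_)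
    rw [Sys.surrogate_eq (hB k s ℓ).1]
    linarith [hβ k s ℓ]

/-- A result of the inner loop maximizes the lower bound on the objective that is tight at it. -/
theorem InnerResult.utility_le (hΘ : 0 < Sys.Θ) (hμ : ∀ k, 0 ≤ Sys.μ k) {t : ℕ}
    {W : FinSchedule L M d t} (h : Sys.InnerResult W) :
    W ∈ Sys.finFeasible t ∧ ∀ Z ∈ Sys.finFeasible t,
      Sys.utility (Sys.accSurrogate W Z) ≤ Sys.utility (Sys.accSurrogate W W) := by
  obtain ⟨w, hw0, hstep, hcl⟩ := h
  have hfeas : ∀ i, w i ∈ Sys.finFeasible t := fun i => by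
    cases i with
    | zero => exact hw0
    | succ i => exact (hstep i).mem_finFeasible
  -- The next iterate is optimal for the minorant at `w i`, and its true rates only improve on that
  -- minorant.
  have hdom : ∀ i, ∀ Z ∈ Sys.finFeasible t, Sys.utility (Sys.accSurrogate (w i) Z) ≤
      Sys.utility (Sys.accSurrogate (w (i + 1)) (w (i + 1))) := fun i Z hZ => by
    refine ((hstep i).utility_le hΘ hμ hZ).trans (Sys.utility_mono hΘ hμ fun k u => ?_)
    refine Finset.sum_le_sum fun s _ => Finset.sum_le_sum fun ℓ _ => ?_
    rw [surrogate_self]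
    exact Sys.surrogate_le_rate _ _ _ _
  have hmono : Monotone fun i => Sys.utility (Sys.accSurrogate (w i) (w i)) :=
    monotone_nat_of_le_succ fun i => hdom i (w i) (hfeas i)
  have hcontW : Continuous fun X : FinSchedule L M d t => Sys.utility (Sys.accSurrogate X X) := by
    simp only [utility, accSurrogate, surrogate_self]
    have := Sys.continuous_rate
    fun_prop
  have hlim : ∀ i, Sys.utility (Sys.accSurrogate (w i) (w i)) ≤
      Sys.utility (Sys.accSurrogate W W) := fun i =>
    (isClosed_le continuous_const hcontW).mem_of_mapClusterPt hcl
      ((eventually_ge_atTop i).mono fun j hj => hmono hj)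
  refine ⟨(Sys.isCompact_finFeasible t).isClosed.mem_of_mapClusterPt hcl
    (Eventually.of_forall hfeas), fun Z hZ => ?_⟩
  have hcontZ : Continuous fun X : FinSchedule L M d t => Sys.utility (Sys.accSurrogate X Z) := by
    have h : ∀ k s ℓ, Continuous fun X : FinSchedule L M d t =>
        Sys.surrogate k ℓ (X s ℓ) (Z s ℓ) := fun k s ℓ =>
      (Sys.continuous_surrogate_left k ℓ (Z s ℓ)).comp
        (by fun_prop : Continuous fun X : FinSchedule L M d t => X s ℓ)
    simp only [utility, accSurrogate]
    fun_prop
  -- Here `Z` is fixed and only the base point tends to `W`.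
  exact (isClosed_le hcontZ continuous_const).mem_of_mapClusterPt hcl
    (Eventually.of_forall fun i => (hdom i Z hZ).trans (hlim (i + 1)))

theorem accSurrogate_self {t : ℕ} (W : FinSchedule L M d t) (k : Fin K) (u : Fin t) :
    Sys.accSurrogate W W k u = ∑ s ∈ Finset.Iic u, Sys.intervalRate k (W s) := by
  simp only [accSurrogate, surrogate_self, intervalRate]

theorem concaveOn_accSurrogate {t : ℕ} (W : FinSchedule L M d t) (k : Fin K) (u : Fin t) :
    ConcaveOn ℝ Set.univ fun Z => Sys.accSurrogate W Z k u := by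
  refine ⟨convex_univ, fun X _ Y _ a b ha hb hab => ?_⟩
  simp only [accSurrogate, smul_eq_mul, Finset.mul_sum, ← Finset.sum_add_distrib]
  exact Finset.sum_le_sum fun s _ => Finset.sum_le_sum fun ℓ _ =>
    (concaveOn_wmseBound_mul (Sys.H k ℓ * W s ℓ) (Sys.H k ℓ)).2 (Set.mem_univ (X s ℓ))
      (Set.mem_univ (Y s ℓ)) ha hb hab

theorem continuous_accSurrogate {t : ℕ} (W : FinSchedule L M d t) (k : Fin K) (u : Fin t) :
    Continuous fun Z => Sys.accSurrogate W Z k u := by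
  refine continuous_finsetSum _ fun s _ => continuous_finsetSum _ fun ℓ _ => ?_
  exact (continuous_wmseBound_mul (Sys.H k ℓ * W s ℓ) (Sys.H k ℓ)).comp
    (by fun_prop : Continuous fun Z : FinSchedule L M d t => Z s ℓ)

theorem accSurrogate_update {t : ℕ} (W : FinSchedule L M d t) (k : Fin K) (u s : Fin t)
    (ℓ : Fin L) (V : Matrix (Fin M) (Fin d) ℂ) :
    Sys.accSurrogate W (Function.update W s (Function.update (W s) ℓ V)) k u =
      Sys.accSurrogate W W k u +
        if s ≤ u then Sys.surrogate k ℓ (W s ℓ) V - Sys.rate k ℓ (W s ℓ) else 0 := by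
  rw [← sub_eq_iff_eq_add']
  simp only [accSurrogate, ← Finset.sum_sub_distrib]
  have hne : ∀ s', s' ≠ s → ∑ ℓ', (Sys.surrogate k ℓ' (W s' ℓ')
      (Function.update W s (Function.update (W s) ℓ V) s' ℓ') -
        Sys.surrogate k ℓ' (W s' ℓ') (W s' ℓ')) = 0 := fun s' hs' => by
    simp [Function.update_of_ne hs']
  have heq : ∑ ℓ', (Sys.surrogate k ℓ' (W s ℓ')
      (Function.update W s (Function.update (W s) ℓ V) s ℓ') -
        Sys.surrogate k ℓ' (W s ℓ') (W s ℓ')) =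
      Sys.surrogate k ℓ (W s ℓ) V - Sys.rate k ℓ (W s ℓ) := by
    rw [Finset.sum_eq_single ℓ]
    · simp [surrogate_self]
    · intro ℓ' _ h
      simp [Function.update_of_ne h]
    · simp
  split_ifs with h
  · rw [Finset.sum_eq_single s (fun s' _ hs' => hne s' hs') (by simp [h]), heq]
  · exact Finset.sum_eq_zero fun s' hs' => hne s' fun he => h (he ▸ Finset.mem_Iic.1 hs')

/-- For nonnegative weights `c`, the multiplier rule at a maximizer
of the weighted lower bound that is tight there holds for the weighted sum of the rates. -/
theorem exists_multiplier_rate (hP : 0 < Sys.P) {ℓ : Fin L} {W : Matrix (Fin M) (Fin d) ℂ}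
    (hW : W ∈ Sys.codebook) {c : Fin K → ℝ} (hc : ∀ k, 0 ≤ c k)
    (hmax : ∀ V ∈ Sys.codebook,
      ∑ k, c k * Sys.surrogate k ℓ W V ≤ ∑ k, c k * Sys.surrogate k ℓ W W) :
    ∃ δ : ℝ, 0 ≤ δ ∧ δ * (‖W‖ ^ 2 - Sys.P) = 0 ∧ HasFDerivAt (𝕜 := ℝ)
      (fun V : Matrix (Fin M) (Fin d) ℂ =>
        -(∑ k, c k * Sys.rate k ℓ V) + δ * (‖V‖ ^ 2 - Sys.P)) 0 W := by
  have hds : Differentiable ℝ fun V => ∑ k, c k * Sys.surrogate k ℓ W V :=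
    Differentiable.fun_sum fun k _ => (differentiable_const _).mul
      (differentiable_wmseBound_mul (Sys.H k ℓ * W) (Sys.H k ℓ))
  have hdr : Differentiable ℝ fun V => ∑ k, c k * Sys.rate k ℓ V :=
    Differentiable.fun_sum fun k _ => (differentiable_const _).mul (Sys.differentiable_rate k ℓ)
  have hs := (hds W).hasFDerivAt
  have hr := (hdr W).hasFDerivAt
  have hq := (differentiable_frobenius_norm_sq W).hasFDerivAt
  -- Rate minus minorant has its minimum zero at `W`, so the two derivatives agree there.
  have hsame := IsLocalMin.hasFDerivAt_eq_zero (a := W) (Eventually.of_forall fun V => by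
    have : ∑ k, c k * Sys.surrogate k ℓ W V ≤ ∑ k, c k * Sys.rate k ℓ V :=
      Finset.sum_le_sum fun k _ =>
        mul_le_mul_of_nonneg_left (Sys.surrogate_le_rate k ℓ W V) (hc k)
    simp only [Pi.sub_apply, surrogate_self, sub_self]
    linarith) (hr.sub hs)
  obtain ⟨δ, hδ, hcomp, he⟩ := exists_multiplier_of_isMaxOn (v := W) (c := Sys.P) hs hq hW
    (fun h => by
      rw [hq.norm_sq_apply_self, h]
      linarith) hmax
  refine ⟨δ, hδ, hcomp, ?_⟩
  have hfin := hr.neg.add ((hq.sub_const Sys.P).const_mul δ)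
  rw [sub_eq_zero.1 hsame, he, neg_add_cancel] at hfin
  exact hfin

/-- The KKT conditions over `t` scheduling intervals, with the multipliers `lam` of the
constraints that couple the relaxed indicators with the accumulated rates. -/
def IsFinKKT (Sys : MulticastSystem K L M d N) {t : ℕ} (W : FinSchedule L M d t)
    (lam : Fin K → Fin t → ℝ) : Prop :=
  (∀ k u, 0 ≤ lam k u ∧ 0 ≤ Sys.μ k - Sys.Θ * lam k u ∧
    lam k u * (Sys.Θ * min ((∑ s ∈ Finset.Iic u, Sys.intervalRate k (W s)) / Sys.Θ) 1 -
      ∑ s ∈ Finset.Iic u, Sys.intervalRate k (W s)) = 0 ∧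
    (Sys.μ k - Sys.Θ * lam k u) *
      (min ((∑ s ∈ Finset.Iic u, Sys.intervalRate k (W s)) / Sys.Θ) 1 - 1) = 0) ∧
  ∀ s ℓ, W s ℓ ∈ Sys.codebook ∧ ∃ δ : ℝ, 0 ≤ δ ∧ δ * (‖W s ℓ‖ ^ 2 - Sys.P) = 0 ∧
    HasFDerivAt (𝕜 := ℝ) (fun V : Matrix (Fin M) (Fin d) ℂ =>
      -(∑ k, (∑ u ∈ Finset.Ici s, lam k u) * Sys.rate k ℓ V) + δ * (‖V‖ ^ 2 - Sys.P)) 0 (W s ℓ)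

theorem InnerResult.exists_isFinKKT (hΘ : 0 < Sys.Θ) (hμ : ∀ k, 0 ≤ Sys.μ k) (hP : 0 < Sys.P)
    {t : ℕ} {W : FinSchedule L M d t} (h : Sys.InnerResult W) :
    ∃ lam, Sys.IsFinKKT W lam := by
  obtain ⟨hW, hmax⟩ := h.utility_le hΘ hμ
  obtain ⟨lam, hlam, hopt⟩ := exists_multipliers_of_isMaxOn_sum_min (ι := Fin K × Fin t)
    (Sys.convex_finFeasible t) (Sys.isCompact_finFeasible t)
    (a := fun i Z => Sys.accSurrogate W Z i.1 i.2)
    (fun i => (concaveOn_accSurrogate W i.1 i.2).subset (Set.subset_univ _)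
      (Sys.convex_finFeasible t))
    (fun i => (continuous_accSurrogate W i.1 i.2).continuousOn)
    (μ := fun i => Sys.μ i.1) (fun i => hμ i.1) hΘ hW
    (fun Z hZ => by simpa only [utility, Fintype.sum_prod_type] using hmax Z hZ)
  refine ⟨fun k u => lam (k, u), fun k u => ?_, fun s ℓ => ⟨hW s ℓ, ?_⟩⟩
  · simpa only [accSurrogate_self] using hlam (k, u)
  refine exists_multiplier_rate hP (hW s ℓ)
    (fun k => Finset.sum_nonneg fun u _ => (hlam (k, u)).1) fun V hV => ?_
  -- Slot `(s, ℓ)` enters the accumulated rate of every `u ≥ s`, so varying it alone yields the tail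
  -- sums of `lam` as weights.
  have h1 := hopt (Function.update W s (Function.update (W s) ℓ V)) fun s' ℓ' => by
    by_cases hs : s' = s
    · subst hs
      by_cases hℓ : ℓ' = ℓ
      · subst hℓ
        simpa using hV
      · simpa [Function.update_of_ne hℓ] using hW s' ℓ'
    · simpa [Function.update_of_ne hs] using hW s' ℓ'
  simp only [accSurrogate_update, mul_add, Finset.sum_add_distrib, Fintype.sum_prod_type,
    add_le_iff_nonpos_right, mul_ite, mul_zero] at h1
  rw [← sub_nonpos, ← Finset.sum_sub_distrib]
  refine le_trans (le_of_eq (Finset.sum_congr rfl fun k _ => ?_)) h1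
  rw [← Finset.sum_filter, ← mul_sub, Finset.sum_mul, surrogate_self]
  exact Finset.sum_congr (by ext; simp) fun u _ => rfl

end MulticastSystem

namespace MulticastSystem

variable {K L M d : ℕ} {N : Fin K → ℕ} {Sys : MulticastSystem K L M d N}

/-! ### The outer loop -/

/-- A positive rate forces a nonzero precoder within the budget. Positivity of `P` is needed for
regularity of the active power constraint. -/
theorem power_pos {V : Fin L → Matrix (Fin M) (Fin d) ℂ} (hV : ∀ ℓ, V ℓ ∈ Sys.codebook)
    {k : Fin K} (hΔ : 0 < Sys.intervalRate k V) : 0 < Sys.P := by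
  obtain ⟨ℓ, -, hℓ⟩ := Finset.exists_ne_zero_of_sum_ne_zero hΔ.ne'
  have hne : V ℓ ≠ 0 := fun h => hℓ (by rw [h, rate_zero])
  exact (pow_pos (norm_pos_iff.2 hne) 2).trans_le (hV ℓ)

theorem zero_mem_codebook {W : Matrix (Fin M) (Fin d) ℂ} (hW : W ∈ Sys.codebook) :
    (0 : Matrix (Fin M) (Fin d) ℂ) ∈ Sys.codebook := by
  have h : (0 : ℝ) ≤ Sys.P := (sq_nonneg _).trans hW
  simpa [codebook] using h

theorem intervalRate_zero (k : Fin K) : Sys.intervalRate k 0 = 0 := by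
  simp [intervalRate, rate_zero]

/-- The precoder `0` is a critical point of every weighted sum of the rates. -/
theorem hasFDerivAt_sum_rate_zero (ℓ : Fin L) {c : Fin K → ℝ} (hc : ∀ k, 0 ≤ c k) :
    HasFDerivAt (𝕜 := ℝ) (fun V : Matrix (Fin M) (Fin d) ℂ =>
      -(∑ k, c k * Sys.rate k ℓ V) + 0 * (‖V‖ ^ 2 - Sys.P)) 0 0 := by
  have hdr : Differentiable ℝ fun V => ∑ k, c k * Sys.rate k ℓ V :=
    Differentiable.fun_sum fun k _ => (differentiable_const _).mul (Sys.differentiable_rate k ℓ)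
  have h := (hdr 0).hasFDerivAt
  have h0 := IsLocalMin.hasFDerivAt_eq_zero (Eventually.of_forall fun V => by
    simp only [rate_zero, mul_zero, Finset.sum_const_zero]
    exact Finset.sum_nonneg fun k _ => mul_nonneg (hc k) (Sys.rate_nonneg k ℓ V)) h
  have hfin := h.neg.add_const (0 * (‖(0 : Matrix (Fin M) (Fin d) ℂ)‖ ^ 2 - Sys.P))
  rw [h0, neg_zero] at hfin
  simp only [zero_mul] at hfin ⊢
  exact hfin

/-- Covers a run that makes no pass: all accumulated rates are zero, so the multipliers take their
maximal value and `nu = 0`. -/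
theorem isFinKKT_zero (hΘ : 0 < Sys.Θ) (hμ : ∀ k, 0 ≤ Sys.μ k)
    {V : Fin L → Matrix (Fin M) (Fin d) ℂ} (hV : ∀ ℓ, V ℓ ∈ Sys.codebook) (t : ℕ) :
    Sys.IsFinKKT (0 : FinSchedule L M d t) fun k _ => Sys.μ k / Sys.Θ := by
  have hμΘ : ∀ k, 0 ≤ Sys.μ k / Sys.Θ := fun k => div_nonneg (hμ k) hΘ.le
  refine ⟨fun k u => ⟨hμΘ k, ?_, ?_, ?_⟩, fun s ℓ => ⟨zero_mem_codebook (hV ℓ), 0, le_rfl,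
    zero_mul _, hasFDerivAt_sum_rate_zero ℓ fun k => Finset.sum_nonneg fun u _ => hμΘ k⟩⟩
  · rw [mul_div_cancel₀ _ hΘ.ne', sub_self]
  · simp [intervalRate_zero]
  · rw [mul_div_cancel₀ _ hΘ.ne', sub_self, zero_mul]

/-- Each pass starts afresh from its own initialization, so only the last one matters and no
induction is needed. -/
theorem OuterState.exists_isFinKKT (hΘ : 0 < Sys.Θ) (hμ : ∀ k, 0 ≤ Sys.μ k)
    {V : Fin L → Matrix (Fin M) (Fin d) ℂ} (hV : ∀ ℓ, V ℓ ∈ Sys.codebook)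
    (hΔ : ∀ k, 0 < Sys.intervalRate k V) {t₀ t : ℕ} {X : FinSchedule L M d t}
    (h : Sys.OuterState V t₀ t X) : ∃ lam, Sys.IsFinKKT X lam := by
  cases h with
  | init => exact ⟨_, isFinKKT_zero hΘ hμ hV t₀⟩
  | pass _ hk hX =>
    obtain ⟨k, -⟩ := hk
    exact hX.exists_isFinKKT hΘ hμ (power_pos hV (hΔ k))

/-! ### Longer horizons -/

theorem accRate_eq_sum_Iic {t : ℕ} {X : FinSchedule L M d t} {W : Schedule L M d}
    (hWX : ∀ s : Fin t, W s = X s) (k : Fin K) (u : Fin t) :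
    Sys.accRate W k (u + 1) = ∑ s ∈ Finset.Iic u, Sys.intervalRate k (X s) := by
  rw [accRate]
  have himg : Finset.range ((u : ℕ) + 1) = (Finset.Iic u).map Fin.valEmbedding := by
    rw [Fin.map_valEmbedding_Iic]
    ext
    simp
  rw [himg, Finset.sum_map]
  exact Finset.sum_congr rfl fun s _ => by rw [Fin.valEmbedding_apply, hWX]

/-- Extending the multipliers by zero makes their tail sums independent of the horizon. -/
theorem tsum_multipliers {t : ℕ} {T : ℕ∞} (htT : (t : ℕ∞) ≤ T) (lam : Fin t → ℝ) (s : Fin t) :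
    ∑' u : {u : ℕ // (s : ℕ) ≤ u ∧ (u : ℕ∞) < T}, (if h : (u : ℕ) < t then lam ⟨u, h⟩ else 0) =
      ∑ u ∈ Finset.Ici s, lam u := by
  have hlt : ∀ u : Fin t, ((u : ℕ) : ℕ∞) < T := fun u =>
    (Nat.cast_lt.2 u.2).trans_le htT
  let e : {u : Fin t // s ≤ u} → {u : ℕ // (s : ℕ) ≤ u ∧ (u : ℕ∞) < T} :=
    fun u => ⟨u.1, u.2, hlt u.1⟩
  have he : Function.Injective e := fun u v h => Subtype.ext (Fin.ext (congrArg Subtype.val h))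
  have hsupp : Function.support (fun u : {u : ℕ // (s : ℕ) ≤ u ∧ (u : ℕ∞) < T} =>
      if h : (u : ℕ) < t then lam ⟨u, h⟩ else 0) ⊆ Set.range e := fun u hu => by
    by_cases h : (u : ℕ) < t
    · exact ⟨⟨⟨u, h⟩, u.2.1⟩, rfl⟩
    · simp [h] at hu
  rw [← he.tsum_eq hsupp, tsum_fintype]
  simp only [e, Fin.is_lt, dite_true, Fin.eta]
  rw [Finset.sum_subtype (Finset.Ici s) (p := fun u => s ≤ u) (by simp)]

/-- A KKT point over `t` scheduling intervals, followed by feasible precoders that keep every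
accumulated rate above the threshold, is a KKT point over every longer horizon. -/
theorem IsFinKKT.isKKTPoint {t : ℕ} {X : FinSchedule L M d t} {lam : Fin K → Fin t → ℝ}
    (h : Sys.IsFinKKT X lam) (hΘ : 0 < Sys.Θ) (hμ : ∀ k, 0 ≤ Sys.μ k) {W : Schedule L M d}
    (hWX : ∀ s : Fin t, W s = X s) (hW : ∀ s, t ≤ s → ∀ ℓ, W s ℓ ∈ Sys.codebook)
    (hacc : ∀ k u, t ≤ u → Sys.Θ ≤ Sys.accRate W k (u + 1)) {T : ℕ∞} (hT : (t : ℕ∞) ≤ T) :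
    Sys.IsKKTPoint T W := by
  obtain ⟨hlam, hδ⟩ := h
  choose hcb δ hδ0 hδc hder using hδ
  let Lam : Fin K → ℕ → ℝ := fun k u => if h : u < t then lam k ⟨u, h⟩ else 0
  have hLam : ∀ k u, t ≤ u → Lam k u = 0 := fun k u hu => dif_neg (not_lt.2 hu)
  refine ⟨fun s _ ℓ => ?_, Lam, fun k u => Sys.μ k - Lam k u * Sys.Θ,
    fun s ℓ => if h : s < t then δ ⟨s, h⟩ ℓ else 0, fun k => ?_, fun k u _ => ?_, fun s _ ℓ => ?_⟩
  · by_cases hs : s < t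
    · rw [hWX ⟨s, hs⟩]
      exact hcb ⟨s, hs⟩ ℓ
    · exact hW s (not_lt.1 hs) ℓ
  · refine Summable.comp_injective (f := Lam k) ?_ Subtype.val_injective
    exact summable_of_ne_finset_zero (s := Finset.range t) fun u hu =>
      hLam k u (by simpa using hu)
  · by_cases hu : u < t
    · obtain ⟨h1, h2, h3, h4⟩ := hlam k ⟨u, hu⟩
      have ha := accRate_eq_sum_Iic (Sys := Sys) hWX k ⟨u, hu⟩
      have hl : Lam k u = lam k ⟨u, hu⟩ := dif_pos hu
      rw [← ha] at h3 h4
      dsimp only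
      rw [hl, relInd, mul_comm _ Sys.Θ]
      exact ⟨h1, h2, h3, h4, by ring⟩
    · have hge := hacc k u (not_lt.1 hu)
      dsimp only
      rw [hLam k u (not_lt.1 hu), relInd, min_eq_right ((one_le_div hΘ).2 hge)]
      simp [hμ k]
  · by_cases hs : s < t
    · have := hder ⟨s, hs⟩ ℓ
      simp only [dif_pos hs, hWX ⟨s, hs⟩, Lam]
      refine ⟨hδ0 _ _, hδc _ _, ?_⟩
      simpa only [tsum_multipliers hT _ ⟨s, hs⟩] using this
    · have hsum : ∀ k, ∑' u : {u : ℕ // s ≤ u ∧ (u : ℕ∞) < T}, Lam k u = 0 := fun k => by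
        have h0 : ∀ u : {u : ℕ // s ≤ u ∧ (u : ℕ∞) < T}, Lam k u = 0 := fun u =>
          hLam k u ((not_lt.1 hs).trans u.2.1)
        rw [tsum_congr h0, tsum_zero]
      -- With zero weights and `δ = 0` the Lagrangian is constant in this slot, so any feasible
      -- precoder is critical.
      simp only [dif_neg hs, hsum, zero_mul, Finset.sum_const_zero, neg_zero, add_zero]
      exact ⟨le_rfl, trivial, hasFDerivAt_const _ _⟩

theorem isStationaryPoint_of_isKKTPoint (hΘ : 0 < Sys.Θ) {W : Schedule L M d} {t : ℕ}
    (hacc : ∀ k u, t ≤ u → Sys.Θ ≤ Sys.accRate W k (u + 1)) (h : Sys.IsKKTPoint ⊤ W) :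
    Sys.IsStationaryPoint W := by
  refine ⟨fun k => summable_of_ne_finset_zero (s := Finset.range t) fun u hu => ?_, h⟩
  rw [relInd, min_eq_right ((one_le_div hΘ).2 (hacc k u (by simpa using hu))), sub_self, mul_zero]

theorem accRate_eq_of_le {W : Schedule L M d} {n u : ℕ} (hnu : n ≤ u)
    (hW : ∀ s, n ≤ s → W s = 0) (k : Fin K) : Sys.accRate W k u = Sys.accRate W k n := by
  refine (Finset.sum_subset (Finset.range_mono hnu) fun s _ hs => ?_).symm
  rw [hW s (by simpa using hs), intervalRate_zero]

end MulticastSystem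

/-! ### The two forms of the output -/

theorem proposition6 {K L M d : ℕ} {N : Fin K → ℕ} (Sys : MulticastSystem K L M d N)
    (hΘ : 0 < Sys.Θ) (hμ : ∀ k, 0 ≤ Sys.μ k)
    (V : Fin L → Matrix (Fin M) (Fin d) ℂ) (hV : ∀ ℓ, V ℓ ∈ Sys.codebook)
    (hΔ : ∀ k, 0 < Sys.intervalRate k V)
    (t₀ n : ℕ) (W : Schedule L M d) (hW : Sys.IsOutput V t₀ n W) :
    Sys.IsStationaryPoint W ∧ ∀ T : ℕ, n ≤ T → Sys.IsKKTPoint (T : ℕ∞) W := by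
  obtain ⟨t, X, hX, hdone, hout⟩ := hW
  obtain ⟨lam, hlam⟩ := hX.exists_isFinKKT hΘ hμ hV hΔ
  suffices h : (∀ s : Fin t, W s = X s) ∧ (∀ s, t ≤ s → ∀ ℓ, W s ℓ ∈ Sys.codebook) ∧
      (∀ k u, t ≤ u → Sys.Θ ≤ Sys.accRate W k (u + 1)) ∧ t ≤ n by
    obtain ⟨hWX, hWc, hacc, htn⟩ := h
    exact ⟨MulticastSystem.isStationaryPoint_of_isKKTPoint hΘ hacc
      (hlam.isKKTPoint hΘ hμ hWX hWc hacc le_top), fun T hT =>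
      hlam.isKKTPoint hΘ hμ hWX hWc hacc (Nat.cast_le.2 (htn.trans hT))⟩
  rcases hout with ⟨hall, rfl, rfl⟩ | ⟨-, rfl, rfl⟩
  · have hzero : ∀ s, n ≤ s → X.extend s = 0 := fun s hs => dif_neg (not_lt.2 hs)
    refine ⟨fun s => dif_pos s.2, fun s hs ℓ => ?_, fun k u hu => ?_, le_rfl⟩
    · rw [hzero s hs]
      exact MulticastSystem.zero_mem_codebook (hV ℓ)
    · rw [MulticastSystem.accRate_eq_of_le (hu.trans u.le_succ) hzero]
      exact hall k
  · have hnext : X.augment V t = V := by simp [FinSchedule.augment]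
    have hzero : ∀ s, t + 1 ≤ s → X.augment V s = 0 := fun s hs => by
      rw [FinSchedule.augment, dif_neg (by omega), if_neg (by omega)]
    refine ⟨fun s => dif_pos s.2, fun s hs ℓ => ?_, fun k u hu => ?_, t.le_succ⟩
    · rcases hs.eq_or_lt with rfl | hlt
      · rw [hnext]
        exact hV ℓ
      · rw [hzero s hlt]
        exact MulticastSystem.zero_mem_codebook (hV ℓ)
    · rw [MulticastSystem.accRate_eq_of_le (Nat.succ_le_succ hu) hzero,
        MulticastSystem.accRate, Finset.sum_range_succ, hnext]
      have heq : ∑ s ∈ Finset.range t, Sys.intervalRate k (X.augment V s) =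
          Sys.accRate X.extend k t := Finset.sum_congr rfl fun s hs => by
        rw [FinSchedule.augment, FinSchedule.extend, dif_pos (Finset.mem_range.1 hs),
          dif_pos (Finset.mem_range.1 hs)]
      rw [heq]
      linarith [hdone k]
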